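/- Let $F$ be a field of characteristic different from $2$. An $F$-algebra with involution is a pair $(A,\sigma)$, where $A$ is a finite-dimensional simple $F$-algebra with centre $K$ and $\sigma$ is an involution on $A$ such that $F=K\cap \mathrm{Sym}(A,\sigma)$, with $\mathrm{Sym}(A,\sigma)=\{a\in A\mid \sigma(a)=a\}$. Its type is unitary if $K\neq F$; if $K=F$ and $\dim_F A=n^2$, it is orthogonal or symplectic according to whether $\dim_F\mathrm{Sym}(A,\sigma)$ is $n(n+1)/2$ or $n(n-1)/2$. Let $\mathrm{Herm}(A,\sigma)$ be the category of (possibly singular) hermitian forms over $(A,\sigma)$ on finitely generated right $A$-modules. For $(M,h)\in\mathrm{Herm}(A,\sigma)$ let $D_{(A,\sigma)}(h)=\{u\in\mathrm{Sym}(A,\sigma)\mid u=h(x,x)\text{ for some }x\in M\}$, and for $a_1,\dots,a_k\in\mathrm{Sym}(A,\sigma)$ let $\langle a_1,\dots,a_k\rangle_\sigma$ be the diagonal form $(x,y)\mapsto\sum_i\sigma(x_i)a_iy_i$ on $A^k$. For $S\subseteq \mathrm{Sym}(A,\sigma)$ let $\mathrm{Diag}(S)$ be the set of all diagonal forms with coefficients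 in $S$. A prepositive cone on $(A,\sigma)$ is a nonempty set $\mathscr P\subseteq\mathrm{Sym}(A,\sigma)$ such that $\mathscr P+\mathscr P\subseteq\mathscr P$; $\sigma(a)\mathscr Pa\subseteq\mathscr P$ for all $a\in A$; $\mathscr P_F:=\{u\in F\mid u\mathscr P\subseteq\mathscr P\}$ is (the set of nonnegative elements of) an ordering of $F$; and $\mathscr P\cap-\mathscr P=\{0\}$. It is over the ordering $P$ if $\mathscr P_F=P$. A positive cone is a prepositive cone that is maximal with respect to inclusion. Let $Y_{(A,\sigma)}$ and $X_{(A,\sigma)}$ be the sets of prepositive and of positive cones on $(A,\sigma)$. Let $(A,\sigma)$ and $(B,\tau)$ be $F$-algebras with involution whose involutions have the same type, and let $\mathfrak m:\mathrm{Herm}(A,\sigma)\to\mathrm{Herm}(B,\tau)$ be a Morita equivalence of $F$-algebras with involution. That is, $\mathfrak m$ is given by an $A$-$B$-bimodule $N$ on which $F$ acts in the same way from both sides, which is finitely generated over $B$ and for which the left action is an isomorphism $A\cong\mathrm{End}_B(N)$, together with a nonsingular hermitian form $b:N\times N\to B$ over $(B,\tau)$ with $b(ax,y)=b(x,\sigma(a)y)$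 for all $a\in A$ and $x,y\in N$; it sends $(M,h)$ to $M\otimes_AN$ with the form $(x\otimes n,x'\otimes n')\mapsto b(n,h(x,x')n')$. Put $$\mathfrak m_*(\mathscr P):=\bigcup\{D_{(B,\tau)}(\mathfrak m(h))\mid h\in\mathrm{Diag}(\mathscr P)\}.$$ Then: (1) $\mathfrak m_*$ is a bijection from $Y_{(A,\sigma)}$ to $Y_{(B,\tau)}$; (2) it preserves inclusions in both directions: for $\mathscr P,\mathscr Q\in Y_{(A,\sigma)}$ one has $\mathscr P\subseteq\mathscr Q$ if and only if $\mathfrak m_*(\mathscr P)\subseteq\mathfrak m_*(\mathscr Q)$; (3) it restricts to a bijection from $X_{(A,\sigma)}$ to $X_{(B,\tau)}$; (4) if $\mathscr P\in Y_{(A,\sigma)}$ is over an ordering $P$ of $F$, then $\mathfrak m_*(\mathscr P)$ is also over $P$. -/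

import Mathlib

open scoped TensorProduct
open MulOpposite

universe u v w t

namespace PosCone

/-! ### Algebras with involution

The involution of a ring `A` is Mathlib's `star`, and `Sym(A, σ)` is the set of all `a : A` with
`IsSelfAdjoint a`. Right `A`-modules are modules over `Aᵐᵒᵖ`. -/

/-- `(A, star)` is an `F`-algebra with involution: `A` is a finite-dimensional simple `F`-algebra
and `F = Z(A) ∩ Sym(A, star)`. -/
class IsAlgebraWithInvolution (F : Type*) (A : Type*) [Field F] [Ring A] [Algebra F A]
    [StarRing A] : Prop where
  finiteDimensional : FiniteDimensional F A
  isSimpleRing : IsSimpleRing A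
  range_algebraMap :
    Set.range (algebraMap F A) = Set.center A ∩ {a : A | IsSelfAdjoint a}

theorem star_algebraMap (F : Type*) {A : Type*} [Field F] [Ring A] [Algebra F A] [StarRing A]
    [IsAlgebraWithInvolution F A] (c : F) : star (algebraMap F A c) = algebraMap F A c := by
  have h : algebraMap F A c ∈ Set.range (algebraMap F A) := ⟨c, rfl⟩
  rw [IsAlgebraWithInvolution.range_algebraMap] at h
  exact h.2

/-- `Sym(A, star)` as an `F`-subspace of `A`. -/
def symSubspace (F : Type*) (A : Type*) [Field F] [Ring A] [Algebra F A] [StarRing A]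
    [IsAlgebraWithInvolution F A] : Submodule F A where
  carrier := {a | IsSelfAdjoint a}
  add_mem' ha hb := IsSelfAdjoint.add ha hb
  zero_mem' := IsSelfAdjoint.zero A
  smul_mem' c a ha := by
    have ha' : star a = a := ha
    change star (c • a) = c • a
    rw [Algebra.smul_def, star_mul, ha', star_algebraMap F c, Algebra.commutes]

/-- The involution is of the first kind: it is trivial on the centre. -/
def IsFirstKind (A : Type*) [Ring A] [StarRing A] : Prop :=
  ∀ z ∈ Set.center A, star z = z

/-- The involution is of the second kind, i.e. of unitary type. -/
def IsUnitaryType (A : Type*) [Ring A] [StarRing A] : Prop :=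
  ¬ IsFirstKind A

/-- Orthogonal type: first kind and `dim Sym = n (n + 1) / 2`, where `dim A = n ^ 2`. -/
def IsOrthogonalType (F : Type*) (A : Type*) [Field F] [Ring A] [Algebra F A] [StarRing A]
    [IsAlgebraWithInvolution F A] : Prop :=
  IsFirstKind A ∧ ∃ n : ℕ, Module.finrank F A = n ^ 2 ∧
    2 * Module.finrank F (symSubspace F A) = n ^ 2 + n

/-- Symplectic type: first kind and `dim Sym = n (n - 1) / 2`, where `dim A = n ^ 2`. -/
def IsSymplecticType (F : Type*) (A : Type*) [Field F] [Ring A] [Algebra F A] [StarRing A]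
    [IsAlgebraWithInvolution F A] : Prop :=
  IsFirstKind A ∧ ∃ n : ℕ, Module.finrank F A = n ^ 2 ∧
    2 * Module.finrank F (symSubspace F A) + n = n ^ 2

/-- The two involutions have the same type. -/
def SameType (F : Type*) (A B : Type*) [Field F] [Ring A] [Algebra F A] [StarRing A]
    [IsAlgebraWithInvolution F A] [Ring B] [Algebra F B] [StarRing B]
    [IsAlgebraWithInvolution F B] : Prop :=
  (IsOrthogonalType F A ∧ IsOrthogonalType F B) ∨
  (IsSymplecticType F A ∧ IsSymplecticType F B) ∨
  (IsUnitaryType A ∧ IsUnitaryType B)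

/-! ### Hermitian forms -/

/-- A (possibly singular) hermitian form over `(A, star)` on the right `A`-module `M`: it is
biadditive, `h (x a) (y b) = star a * h x y * b` and `star (h x y) = h y x`. -/
structure HermForm (A : Type u) [Ring A] [StarRing A] (M : Type v) [AddCommGroup M]
    [Module Aᵐᵒᵖ M] where
  toFun : M → M → A
  add_right' : ∀ x y z, toFun x (y + z) = toFun x y + toFun x z
  smul_right' : ∀ x y (a : A), toFun x (op a • y) = toFun x y * a
  star_apply' : ∀ x y, star (toFun x y) = toFun y x

namespace HermForm

variable {A : Type u} [Ring A] [StarRing A] {M : Type v} [AddCommGroup M] [Module Aᵐᵒᵖ M]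

instance : CoeFun (HermForm A M) (fun _ => M → M → A) := ⟨HermForm.toFun⟩

variable (h : HermForm A M)

theorem add_right (x y z : M) : h x (y + z) = h x y + h x z := h.add_right' x y z

theorem smul_right (x y : M) (a : A) : h x (op a • y) = h x y * a := h.smul_right' x y a

theorem star_apply (x y : M) : star (h x y) = h y x := h.star_apply' x y

theorem add_left (x y z : M) : h (x + y) z = h x z + h y z := by
  rw [← h.star_apply z (x + y), h.add_right, star_add, h.star_apply, h.star_apply]

theorem smul_left (x y : M) (a : A) : h (op a • x) y = star a * h x y := by
  rw [← h.star_apply y (op a • x), h.smul_right, star_mul, h.star_apply]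

end HermForm

/-- An object of the category `Herm(A, star)`: a finitely generated right `A`-module with a
(possibly singular) hermitian form. -/
structure Herm (A : Type u) [Ring A] [StarRing A] where
  carrier : Type v
  [addCommGroup : AddCommGroup carrier]
  [module : Module Aᵐᵒᵖ carrier]
  [finite : Module.Finite Aᵐᵒᵖ carrier]
  form : HermForm A carrier

attribute [instance] Herm.addCommGroup Herm.module Herm.finite

/-- The set `D(h)` of elements represented by `h`. -/
def Herm.represented {A : Type u} [Ring A] [StarRing A] (h : Herm.{u, v} A) : Set A :=
  {c | IsSelfAdjoint c ∧ ∃ x : h.carrier, h.form x x = c}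

theorem finite_right (A : Type*) [Ring A] : Module.Finite Aᵐᵒᵖ A :=
  ⟨⟨{1}, eq_top_iff.2 fun a _ => by
    rw [Finset.coe_singleton]
    exact Submodule.mem_span_singleton.2 ⟨op a, by simp⟩⟩⟩

/-- The diagonal form `⟨a₁, …, a_k⟩` on `A ^ k`, mapping `(x, y)` to `∑ star (x i) * a i * y i`. -/
def diagForm {A : Type u} [Ring A] [StarRing A] {k : ℕ} (a : Fin k → A)
    (ha : ∀ i, IsSelfAdjoint (a i)) : Herm.{u, u} A where
  carrier := Fin k → A
  finite := haveI := finite_right A; inferInstance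
  form :=
    { toFun := fun x y => ∑ i, star (x i) * a i * y i
      add_right' := fun x y z => by simp [mul_add, Finset.sum_add_distrib]
      smul_right' := fun x y c => by simp [Finset.sum_mul, mul_assoc]
      star_apply' := fun x y => by
        rw [star_sum]
        refine Finset.sum_congr rfl fun i _ => ?_
        rw [star_mul, star_mul, star_star, (ha i).star_eq, mul_assoc] }

/-- `Diag(S)`: the diagonal hermitian forms with coefficients in `S ∩ Sym(A, star)`. -/
def Diag {A : Type u} [Ring A] [StarRing A] (S : Set A) : Set (Herm.{u, u} A) :=
  {h | ∃ (k : ℕ) (a : Fin k → A) (ha : ∀ i, IsSelfAdjoint (a i)),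
    (∀ i, a i ∈ S) ∧ h = diagForm a ha}

/-! ### Prepositive cones -/

/-- `S ⊆ F` is (the set of nonnegative elements of) an ordering of the field `F`. -/
def IsFieldOrdering {F : Type*} [Field F] (S : Set F) : Prop :=
  ∃ O : RingPreordering F, O.IsOrdering ∧ (O : Set F) = S

/-- `P_F = {u ∈ F | u P ⊆ P}`. -/
def coneScalars (F : Type*) {A : Type*} [Field F] [Ring A] [Algebra F A] (P : Set A) : Set F :=
  {u | ∀ p ∈ P, u • p ∈ P}

/-- Prepositive cones on the `F`-algebra with involution `(A, star)`. -/
structure IsPrepositiveCone (F : Type*) {A : Type*} [Field F] [Ring A] [Algebra F A] [StarRing A]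
    (P : Set A) : Prop where
  isSelfAdjoint : ∀ p ∈ P, IsSelfAdjoint p
  nonempty : P.Nonempty
  add_mem : ∀ p ∈ P, ∀ q ∈ P, p + q ∈ P
  conj_mem : ∀ a : A, ∀ p ∈ P, star a * p * a ∈ P
  isFieldOrdering : IsFieldOrdering (coneScalars F P)
  proper : P ∩ {p | -p ∈ P} = {0}

/-- `Y_(A, star)`: the set of all prepositive cones. -/
def prepositiveCones (F : Type*) (A : Type*) [Field F] [Ring A] [Algebra F A] [StarRing A] :
    Set (Set A) :=
  {P | IsPrepositiveCone F P}

/-- `X_(A, star)`: the set of all positive cones, i.e. of the prepositive cones that are maximal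
with respect to inclusion. -/
def positiveCones (F : Type*) (A : Type*) [Field F] [Ring A] [Algebra F A] [StarRing A] :
    Set (Set A) :=
  {P | Maximal (fun Q : Set A => IsPrepositiveCone F Q) P}

/-! ### Morita equivalences of algebras with involution -/

/-- A Morita equivalence from `(A, star)` to `(B, star)` over `F`, for hermitian forms: an
`A`-`B`-bimodule `N` on which `F` acts in the same way from both sides, finitely generated over
`B`, such that the left action identifies `A` with `End_B(N)`, together with a nonsingular
hermitian form `b : N × N → B` whose adjoint involution on `A = End_B(N)` is `star`. (`B` being
simple artinian, a nonzero finitely generated module `N` is automatically a progenerator.) -/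
structure MoritaEquiv (F : Type*) (A : Type u) (B : Type v) [Field F] [Ring A] [Algebra F A]
    [StarRing A] [Ring B] [Algebra F B] [StarRing B] where
  N : Type w
  [addCommGroup : AddCommGroup N]
  [leftModule : Module A N]
  [rightModule : Module Bᵐᵒᵖ N]
  [smulComm : SMulCommClass A Bᵐᵒᵖ N]
  [finite : Module.Finite Bᵐᵒᵖ N]
  algebraMap_smul : ∀ (c : F) (n : N), algebraMap F A c • n = op (algebraMap F B c) • n
  end_bijective : ∀ f : N →ₗ[Bᵐᵒᵖ] N, ∃! a : A, ∀ n, f n = a • n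
  b : HermForm B N
  nonsingular : ∀ f : N →ₗ[Bᵐᵒᵖ] B, ∃! x : N, ∀ y, f y = b x y
  adjoint : ∀ (a : A) (x y : N), b (a • x) y = b x (star a • y)

attribute [instance] MoritaEquiv.addCommGroup MoritaEquiv.leftModule MoritaEquiv.rightModule
  MoritaEquiv.smulComm MoritaEquiv.finite

/-- A biadditive map as a `ℤ`-bilinear map. -/
def biadditive {X Y Z : Type*} [AddCommGroup X] [AddCommGroup Y] [AddCommGroup Z]
    (f : X → Y → Z) (h₁ : ∀ x x' y, f (x + x') y = f x y + f x' y)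
    (h₂ : ∀ x y y', f x (y + y') = f x y + f x y') : X →ₗ[ℤ] Y →ₗ[ℤ] Z :=
  LinearMap.mk₂ ℤ f h₁ (fun c x y => map_zsmul (AddMonoidHom.mk' (f · y) fun x x' => h₁ x x' y) c x)
    h₂ (fun c x y => map_zsmul (AddMonoidHom.mk' (f x) fun y y' => h₂ x y y') c y)

@[simp]
theorem biadditive_apply {X Y Z : Type*} [AddCommGroup X] [AddCommGroup Y] [AddCommGroup Z]
    (f : X → Y → Z) (h₁ : ∀ x x' y, f (x + x') y = f x y + f x' y)
    (h₂ : ∀ x y y', f x (y + y') = f x y + f x y') (x : X) (y : Y) :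
    biadditive f h₁ h₂ x y = f x y := rfl

namespace MoritaEquiv

variable {F : Type*} {A : Type u} {B : Type v} [Field F] [Ring A] [Algebra F A]
    [StarRing A] [Ring B] [Algebra F B] [StarRing B] (m : MoritaEquiv.{u, v, w} F A B)

section tensor

variable (M : Type*) [AddCommGroup M] [Module Aᵐᵒᵖ M]

/-- The relations `m a ⊗ n = m ⊗ a n` defining `M ⊗_A N`. The two factors are written in the order
`N ⊗ M`, so that the right `B`-action of `N` is Mathlib's action on the first factor. -/
def relations : Submodule Bᵐᵒᵖ (m.N ⊗[ℤ] M) :=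
  Submodule.span Bᵐᵒᵖ {z | ∃ (a : A) (n : m.N) (x : M),
    z = (a • n) ⊗ₜ[ℤ] x - n ⊗ₜ[ℤ] (op a • x)}

/-- The right `B`-module `M ⊗_A N`. -/
abbrev Tensor : Type _ := (m.N ⊗[ℤ] M) ⧸ m.relations M

/-- The element `x ⊗ n` of `M ⊗_A N`. -/
def tmul {M : Type*} [AddCommGroup M] [Module Aᵐᵒᵖ M] (x : M) (n : m.N) : m.Tensor M :=
  (m.relations M).mkQ (n ⊗ₜ[ℤ] x)

theorem tmul_smul_left {M : Type*} [AddCommGroup M] [Module Aᵐᵒᵖ M] (x : M) (a : A) (n : m.N) :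
    m.tmul (op a • x) n = m.tmul x (a • n) := by
  symm
  refine (Submodule.Quotient.eq _).2 (Submodule.subset_span ⟨a, n, x, rfl⟩)

end tensor

section form

variable {M : Type*} [AddCommGroup M] [Module Aᵐᵒᵖ M] (h : HermForm A M)

/-- The biadditive map `(n ⊗ x, n' ⊗ x') ↦ b (n, h (x, x') n')` before passing to `M ⊗_A N`. -/
def preForm : (m.N ⊗[ℤ] M) →ₗ[ℤ] (m.N ⊗[ℤ] M) →ₗ[ℤ] B :=
  TensorProduct.lift <| biadditive
    (fun n x => TensorProduct.lift <| biadditive (fun n' x' => m.b n (h x x' • n'))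
      (fun n₁ n₂ x' => by rw [smul_add, m.b.add_right])
      (fun n' x₁ x₂ => by rw [h.add_right, add_smul, m.b.add_right]))
    (fun n₁ n₂ x => by
      refine TensorProduct.ext' fun n' x' => ?_
      exact m.b.add_left n₁ n₂ (h x x' • n'))
    (fun n x₁ x₂ => by
      refine TensorProduct.ext' fun n' x' => ?_
      change m.b n (h (x₁ + x₂) x' • n') = m.b n (h x₁ x' • n') + m.b n (h x₂ x' • n')
      rw [h.add_left, add_smul, m.b.add_right])

@[simp]
theorem preForm_tmul (n n' : m.N) (x x' : M) :
    m.preForm h (n ⊗ₜ x) (n' ⊗ₜ x') = m.b n (h x x' • n') := rfl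

theorem preForm_star (z z' : m.N ⊗[ℤ] M) :
    star (m.preForm h z z') = m.preForm h z' z := by
  induction z using TensorProduct.induction_on with
  | zero => simp
  | add z₁ z₂ h₁ h₂ => simp [h₁, h₂]
  | tmul n x =>
    induction z' using TensorProduct.induction_on with
    | zero => simp
    | add z₁ z₂ h₁ h₂ => simp [h₁, h₂]
    | tmul n' x' =>
      rw [preForm_tmul, preForm_tmul, m.b.star_apply, m.adjoint, h.star_apply]

theorem preForm_smul_right (z z' : m.N ⊗[ℤ] M) (c : B) :
    m.preForm h z (op c • z') = m.preForm h z z' * c := by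
  induction z using TensorProduct.induction_on with
  | zero => simp
  | add z₁ z₂ h₁ h₂ => simp [h₁, h₂, add_mul]
  | tmul n x =>
    induction z' using TensorProduct.induction_on with
    | zero => simp
    | add z₁ z₂ h₁ h₂ => simp [h₁, h₂, add_mul]
    | tmul n' x' =>
      rw [TensorProduct.smul_tmul', preForm_tmul, preForm_tmul, smul_comm, m.b.smul_right]

theorem preForm_right_eq_zero (z : m.N ⊗[ℤ] M) {z' : m.N ⊗[ℤ] M} (hz' : z' ∈ m.relations M) :
    m.preForm h z z' = 0 := by
  refine Submodule.span_induction ?_ (by simp) (fun x y _ _ hx hy => by simp [hx, hy])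
    (fun c x _ hx => by
      have := m.preForm_smul_right h z x c.unop
      rw [op_unop] at this
      rw [this, hx, zero_mul]) hz'
  rintro _ ⟨a, n', x', rfl⟩
  induction z using TensorProduct.induction_on with
  | zero => simp
  | add z₁ z₂ h₁ h₂ =>
    rw [map_add, LinearMap.add_apply, h₁, h₂, add_zero]
  | tmul n x =>
    rw [map_sub, preForm_tmul, preForm_tmul, h.smul_right, mul_smul, sub_self]

theorem preForm_left_eq_zero {z : m.N ⊗[ℤ] M} (hz : z ∈ m.relations M) (z' : m.N ⊗[ℤ] M) :
    m.preForm h z z' = 0 := by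
  rw [← m.preForm_star, m.preForm_right_eq_zero h z' hz, star_zero]

/-- The hermitian form on `M ⊗_A N` with `(x ⊗ n, x' ⊗ n') ↦ b (n, h (x, x') n')`. -/
def tensorForm : HermForm B (m.Tensor M) where
  toFun := fun p q => Quotient.liftOn₂' p q (fun z z' => m.preForm h z z') (by
    intro z₁ z₁' z₂ z₂' hz hz'
    rw [Submodule.quotientRel_def] at hz hz'
    have e₁ := m.preForm_left_eq_zero h hz z₁'
    have e₂ := m.preForm_right_eq_zero h z₂ hz'
    rw [map_sub, LinearMap.sub_apply, sub_eq_zero] at e₁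
    rw [map_sub, sub_eq_zero] at e₂
    exact e₁.trans e₂)
  add_right' := by
    rintro ⟨x⟩ ⟨y⟩ ⟨z⟩
    exact map_add (m.preForm h x) y z
  smul_right' := by
    rintro ⟨x⟩ ⟨y⟩ c
    exact m.preForm_smul_right h x y c
  star_apply' := by
    rintro ⟨x⟩ ⟨y⟩
    exact m.preForm_star h x y

theorem tensorForm_tmul (x x' : M) (n n' : m.N) :
    m.tensorForm h (m.tmul x n) (m.tmul x' n') = m.b n (h x x' • n') := rfl

end form

theorem tensor_finite (M : Type*) [AddCommGroup M] [Module Aᵐᵒᵖ M] [Module.Finite Aᵐᵒᵖ M] :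
    Module.Finite Bᵐᵒᵖ (m.Tensor M) := by
  classical
  obtain ⟨S, hS⟩ := Module.Finite.fg_top (R := Bᵐᵒᵖ) (M := m.N)
  obtain ⟨T, hT⟩ := Module.Finite.fg_top (R := Aᵐᵒᵖ) (M := M)
  refine ⟨⟨(T ×ˢ S).image fun p => m.tmul p.1 p.2, eq_top_iff.2 ?_⟩⟩
  set W := Submodule.span Bᵐᵒᵖ ((((T ×ˢ S).image fun p => m.tmul p.1 p.2 : Finset (m.Tensor M))) :
    Set (m.Tensor M)) with hW
  have h₁ : ∀ t ∈ T, ∀ n : m.N, m.tmul t n ∈ W := by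
    intro t ht n
    have hn : n ∈ Submodule.span Bᵐᵒᵖ (S : Set m.N) := hS ▸ Submodule.mem_top
    induction hn using Submodule.span_induction with
    | mem s hs =>
      exact Submodule.subset_span (Finset.mem_coe.2 (Finset.mem_image.2
        ⟨(t, s), Finset.mem_product.2 ⟨ht, hs⟩, rfl⟩))
    | zero => simp [tmul]
    | add x y _ _ hx hy =>
      have : m.tmul t (x + y) = m.tmul t x + m.tmul t y := by
        simp only [tmul, TensorProduct.add_tmul, map_add]
      exact this ▸ W.add_mem hx hy
    | smul c x _ hx =>
      have : m.tmul t (c • x) = c • m.tmul t x := by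
        simp only [tmul, ← TensorProduct.smul_tmul', map_smul]
      exact this ▸ W.smul_mem c hx
  have h₂ : ∀ (x : M) (n : m.N), m.tmul x n ∈ W := by
    intro x
    have hx : x ∈ Submodule.span Aᵐᵒᵖ (T : Set M) := hT ▸ Submodule.mem_top
    induction hx using Submodule.span_induction with
    | mem t ht => exact h₁ t ht
    | zero => intro n; simp [tmul]
    | add x y _ _ hx hy =>
      intro n
      have : m.tmul (x + y) n = m.tmul x n + m.tmul y n := by
        simp only [tmul, TensorProduct.tmul_add, map_add]
      exact this ▸ W.add_mem (hx n) (hy n)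
    | smul c x _ hx =>
      intro n
      have := m.tmul_smul_left x c.unop n
      rw [op_unop] at this
      exact this ▸ hx _
  intro z _
  obtain ⟨z, rfl⟩ := (m.relations M).mkQ_surjective z
  induction z using TensorProduct.induction_on with
  | zero => simp
  | add z₁ z₂ h₁ h₂ => rw [map_add]; exact W.add_mem (h₁ trivial) (h₂ trivial)
  | tmul n x => exact h₂ x n

/-- The functor `𝔪 : Herm(A, star) → Herm(B, star)` on objects, `(M, h) ↦ (M ⊗_A N, b h)`. -/
def obj (h : Herm.{u, t} A) : Herm.{v, max t w} B :=
  haveI := m.tensor_finite h.carrier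
  { carrier := m.Tensor h.carrier
    form := m.tensorForm h.form }

/-- `𝔪_*(P) = ⋃ {D(𝔪(h)) | h ∈ Diag(P)}`. -/
def mapCone (P : Set A) : Set B :=
  ⋃ h ∈ Diag P, (m.obj h).represented

end MoritaEquiv

end PosCone

open PosCone

namespace PosCone

/-! ### Simple rings and regular elements -/

/-! Since `A^k ⊗_A N` is `N^k`, the form `𝔪(⟨a₁, …, a_k⟩)` represents exactly the sums of the
elements `b(n_i, a_i n_i)`. Hence `𝔪_*(P)` is the additive monoid generated by the images of `P`
under the maps `φ_n : a ↦ b(n, a n)` (`mapCone_eq_coneSpan`). The inverse should come from the maps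
`ψ_n : c ↦ n c b(n, ·)` from `B` to `End_B(N) = A`. No inverse Morita equivalence is built:
`ConeTransfer` lists conditions that both families satisfy, with roles exchanged, and everything
follows from these.

Each composite `ψ_k φ_n` is a conjugation `a ↦ σ(x) a x`, so going forth and back stays inside `P`.
Conversely, Gram-Schmidt splits any `p ∈ P` orthogonally into pieces that are values of such
composites (`mem_coneSpan_coneSpan`). Because singular forms occur and `A`, `B` need not be division
rings, the inversion of `φ_n(p)` is replaced by a self-adjoint generalised inverse, which
semisimplicity provides.

Properness and the scalars are transported because a nonzero self-adjoint element is not killed by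
the whole family: by polarisation it would otherwise yield a two-sided ideal of skew elements
containing `1`, against `2 ≠ 0`. -/

theorem one_mem_closure_of_absorbing {R : Type*} [Ring R] [IsSimpleRing R] {s : Set R}
    (hl : ∀ a, ∀ x ∈ s, a * x ∈ s) (hr : ∀ a, ∀ x ∈ s, x * a ∈ s) {x : R} (hx : x ∈ s)
    (hx0 : x ≠ 0) : (1 : R) ∈ AddSubgroup.closure s := by
  -- The additive subgroup generated by an absorbing set is already a two-sided ideal.
  have key := IsSimpleRing.one_mem_of_ne_zero_mem
    (TwoSidedIdeal.mk' (AddSubgroup.closure s : Set R) (zero_mem _) add_mem neg_mem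
      (fun {a y} hy => by
        induction hy using AddSubgroup.closure_induction with
        | mem z hz => exact AddSubgroup.subset_closure (hl a z hz)
        | zero => simp
        | add z w _ _ hz hw => rw [mul_add]; exact add_mem hz hw
        | neg z _ hz => rw [mul_neg]; exact neg_mem hz)
      (fun {y a} hy => by
        induction hy using AddSubgroup.closure_induction with
        | mem z hz => exact AddSubgroup.subset_closure (hr a z hz)
        | zero => simp
        | add z w _ _ hz hw => rw [add_mul]; exact add_mem hz hw
        | neg z _ hz => rw [neg_mul]; exact neg_mem hz)) hx0
    ((TwoSidedIdeal.mem_mk' ..).2 (AddSubgroup.subset_closure hx))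
  exact (TwoSidedIdeal.mem_mk' ..).1 key

/-- Semisimple rings are von Neumann regular. -/
theorem exists_mul_mul_eq_self {R : Type*} [Ring R] [IsSemisimpleRing R] (c : R) :
    ∃ y, c * y * c = c := by
  obtain ⟨J, hJ⟩ := exists_isCompl (Ideal.span {c})
  have h1 : (1 : R) ∈ Ideal.span {c} ⊔ J := by rw [hJ.sup_eq_top]; trivial
  obtain ⟨z, hz, j, hj, hzj⟩ := Submodule.mem_sup.1 h1
  obtain ⟨y, rfl⟩ := Ideal.mem_span_singleton'.1 hz
  refine ⟨y, ?_⟩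
  -- With `1 = y c + j`, the defect `c - c y c` lies in the left ideal of `c` and in its complement,
  -- so it vanishes.
  have hcj : c * j = c - c * y * c := by
    rw [eq_sub_iff_add_eq', mul_assoc, ← mul_add, hzj, mul_one]
  have hmem : c * j ∈ Ideal.span {c} ⊓ J := by
    refine ⟨?_, J.smul_mem c hj⟩
    rw [hcj]
    exact sub_mem (Ideal.mem_span_singleton_self c) (Ideal.mul_mem_left _ _
      (Ideal.mem_span_singleton_self c))
  rw [hJ.inf_eq_bot, Submodule.mem_bot, hcj, sub_eq_zero] at hmem
  exact hmem.symm

/-- In a semisimple ring with involution, a self-adjoint element has a self-adjoint reflexive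
generalised inverse. -/
theorem exists_isSelfAdjoint_generalized_inverse {R : Type*} [Ring R] [StarRing R]
    [IsSemisimpleRing R] {c : R} (hc : IsSelfAdjoint c) :
    ∃ d, IsSelfAdjoint d ∧ d * c * d = d ∧ c * d * c = c := by
  obtain ⟨y, hy⟩ := exists_mul_mul_eq_self c
  have hy' : c * star y * c = c := by
    have := congrArg star hy
    rwa [star_mul, star_mul, hc.star_eq, ← mul_assoc] at this
  -- Both `y` and `star y` are generalised inverses of `c`; sandwiching `c` between them gives a
  -- symmetric and reflexive one.
  refine ⟨star y * c * y, ?_, ?_, ?_⟩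
  · rw [isSelfAdjoint_iff, star_mul, star_mul, star_star, hc.star_eq, mul_assoc]
  · calc star y * c * y * c * (star y * c * y) = star y * (c * y * c) * star y * c * y := by
          noncomm_ring
      _ = star y * (c * star y * c) * y := by rw [hy]; noncomm_ring
      _ = star y * c * y := by rw [hy']
  · calc c * (star y * c * y) * c = c * star y * (c * y * c) := by noncomm_ring
      _ = c := by rw [hy, hy']

/-- Skewness is additive while `1` is symmetric, so membership would give `2 = 0`. Together with
`one_mem_closure_of_absorbing` this rules out nonzero absorbing sets of skew elements. -/
theorem one_notMem_closure_of_skew {F R : Type*} [Field F] (hF : (2 : F) ≠ 0) [Ring R]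
    [Algebra F R] [StarRing R] [Nontrivial R] {s : Set R} (hs : ∀ x ∈ s, star x = -x) :
    (1 : R) ∉ AddSubgroup.closure s := by
  intro h1
  have h : ∀ x ∈ AddSubgroup.closure s, star x = -x := fun x hx => by
    induction hx using AddSubgroup.closure_induction with
    | mem z hz => exact hs z hz
    | zero => simp
    | add z w _ _ hz hw => rw [star_add, hz, hw, neg_add]
    | neg z _ hz => rw [star_neg, hz]
  have h2 := h 1 h1
  rw [star_one, eq_neg_iff_add_eq_zero, one_add_one_eq_two] at h2
  apply hF
  apply (algebraMap F R).injective
  rw [map_ofNat, h2, map_zero]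

/-! ### Transfer of cones along families of linear maps -/

section transfer

variable {F R S ι : Type*} [Field F] [Ring R] [Algebra F R] [Ring S] [Algebra F S]

/-- The additive monoid generated by the images of `P` under all `φ i`. -/
def coneSpan (φ : ι → R →ₗ[F] S) (P : Set R) : Set S :=
  AddSubmonoid.closure {s | ∃ i, ∃ p ∈ P, φ i p = s}

theorem coneSpan_mono (φ : ι → R →ₗ[F] S) {P Q : Set R} (h : P ⊆ Q) :
    coneSpan φ P ⊆ coneSpan φ Q := by
  refine AddSubmonoid.closure_mono ?_
  rintro _ ⟨i, p, hp, rfl⟩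
  exact ⟨i, p, h hp, rfl⟩

variable [StarRing R] [StarRing S]

/-- Families of maps `φ i : R → S` and `ψ i : S → R` that behave like `r ↦ b (n, r n)` and
`s ↦ n s b (n, ·)` for a hermitian form `b` on a bimodule. -/
structure ConeTransfer (φ : ι → R →ₗ[F] S) (ψ : ι → S →ₗ[F] R) : Prop where
  isSelfAdjoint : ∀ i r, IsSelfAdjoint r → IsSelfAdjoint (φ i r)
  conj : ∀ i r s, ∃ j, star s * φ i r * s = φ j r
  comp : ∀ i j r, ∃ a, ψ j (φ i r) = star a * r * a
  exists_ne_zero : ∀ r, IsSelfAdjoint r → r ≠ 0 → ∃ i, φ i r ≠ 0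
  -- One Gram-Schmidt step: `e` is an orthogonal projection for the form `⟨r⟩`, nontrivial on it,
  -- and the summand it cuts out comes from `ψ j ∘ φ i`.
  exists_idempotent : ∀ r, IsSelfAdjoint r → r ≠ 0 → ∃ e, e * e = e ∧ r * e = star e * r ∧
    r * e ≠ 0 ∧ ∃ i j, star e * r * e = ψ j (φ i r)

theorem IsPrepositiveCone.zero_mem {P : Set R} (hP : IsPrepositiveCone F P) : (0 : R) ∈ P := by
  have h : (0 : R) ∈ P ∩ {p | -p ∈ P} := by rw [hP.proper]; rfl
  exact h.1

theorem IsPrepositiveCone.eq_zero {P : Set R} (hP : IsPrepositiveCone F P) {p : R} (hp : p ∈ P)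
    (hp' : -p ∈ P) : p = 0 := by
  have h : p ∈ P ∩ {p | -p ∈ P} := ⟨hp, hp'⟩
  rwa [hP.proper] at h

/-- Every scalar, in particular `-1`, preserves the zero cone, but no ordering contains `-1`. -/
theorem IsPrepositiveCone.exists_ne_zero {P : Set R} (hP : IsPrepositiveCone F P) :
    ∃ p ∈ P, p ≠ 0 := by
  by_contra! h
  obtain ⟨O, -, hO⟩ := hP.isFieldOrdering
  apply O.neg_one_notMem
  rw [← SetLike.mem_coe, hO]
  intro p hp
  rw [h p hp, smul_zero]
  exact hP.zero_mem

theorem IsPrepositiveCone.scalars_mem_or_neg_mem {P : Set R} (hP : IsPrepositiveCone F P)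
    (u : F) : u ∈ coneScalars F P ∨ -u ∈ coneScalars F P := by
  obtain ⟨O, hOrd, hO⟩ := hP.isFieldOrdering
  rw [← hO]
  exact mem_or_neg_mem O u

/-! ### Consequences of the transfer conditions -/

namespace ConeTransfer

variable {φ : ι → R →ₗ[F] S} {ψ : ι → S →ₗ[F] R}

theorem isSelfAdjoint_coneSpan (hφ : ConeTransfer φ ψ) {P : Set R}
    (hP : IsPrepositiveCone F P) {s : S} (hs : s ∈ coneSpan φ P) : IsSelfAdjoint s := by
  induction hs using AddSubmonoid.closure_induction with
  | mem z hz =>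
    obtain ⟨i, p, hp, rfl⟩ := hz
    exact hφ.isSelfAdjoint i p (hP.isSelfAdjoint p hp)
  | zero => exact .zero S
  | add z w _ _ hz hw => exact hz.add hw

theorem apply_mem_of_mem_coneSpan (hφ : ConeTransfer φ ψ) {P : Set R}
    (hP : IsPrepositiveCone F P) {s : S} (hs : s ∈ coneSpan φ P) (j : ι) : ψ j s ∈ P := by
  induction hs using AddSubmonoid.closure_induction with
  | mem z hz =>
    obtain ⟨i, p, hp, rfl⟩ := hz
    obtain ⟨a, ha⟩ := hφ.comp i j p
    rw [ha]
    exact hP.conj_mem a p hp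
  | zero => rw [map_zero]; exact hP.zero_mem
  | add z w _ _ hz hw => rw [map_add]; exact hP.add_mem _ hz _ hw

/-- Diagonalisation by induction on the dimension of `p R`: split off `star e * p * e` and continue
with the orthogonal complement, which stays in `P` because it is a conjugate of `p`. -/
theorem mem_coneSpan_coneSpan (hφ : ConeTransfer φ ψ) [FiniteDimensional F R] {P : Set R}
    (hP : IsPrepositiveCone F P) {p : R} (hp : p ∈ P) : p ∈ coneSpan ψ (coneSpan φ P) := by
  induction hk : Module.finrank F (LinearMap.range (LinearMap.mulLeft F p)) using
    Nat.strong_induction_on generalizing p with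
  | _ k ih =>
  subst hk
  by_cases hp0 : p = 0
  · rw [hp0]; exact AddSubmonoid.zero_mem _
  obtain ⟨e, hee, hpe, hpe0, i, j, hij⟩ := hφ.exists_idempotent p (hP.isSelfAdjoint p hp) hp0
  have hconj : star (1 - e) * p * (1 - e) = p * (1 - e) := by
    have h : p * e * e = p * e := by rw [mul_assoc, hee]
    rw [star_sub, star_one, sub_mul, one_mul, ← hpe, mul_sub, mul_one, sub_mul, h, sub_self,
      sub_zero, mul_sub, mul_one]
  have hmem : p * (1 - e) ∈ P := hconj ▸ hP.conj_mem (1 - e) p hp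
  have hsplit : p = star e * p * e + p * (1 - e) := by
    rw [← hpe, mul_assoc, hee, mul_sub, mul_one, add_sub_cancel]
  -- Left multiplication by `star e` kills `p (1 - e) R` but fixes `p e ≠ 0`, so the inclusion is
  -- strict.
  have hlt : LinearMap.range (LinearMap.mulLeft F (p * (1 - e))) <
      LinearMap.range (LinearMap.mulLeft F p) := by
    refine lt_of_le_of_ne ?_ fun heq => hpe0 ?_
    · rintro _ ⟨x, rfl⟩
      exact ⟨(1 - e) * x, by simp⟩
    · have hin : p * e ∈ LinearMap.range (LinearMap.mulLeft F (p * (1 - e))) := by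
        rw [heq]; exact ⟨e, rfl⟩
      obtain ⟨x, hx⟩ := hin
      rw [LinearMap.mulLeft_apply] at hx
      have h1 : star e * (p * e) = p * e := by rw [← mul_assoc, ← hpe, mul_assoc, hee]
      have h2 : star e * (p * (1 - e)) = 0 := by
        rw [← mul_assoc, ← hpe, mul_sub, mul_one, mul_assoc, hee, sub_self]
      rw [← h1, ← hx, ← mul_assoc, h2, zero_mul]
  have hrest := ih _ (Submodule.finrank_lt_finrank_of_lt hlt) hmem rfl
  rw [hsplit, hij]
  refine AddSubmonoid.add_mem _ (AddSubmonoid.subset_closure ⟨j, φ i p, ?_, rfl⟩) hrest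
  exact AddSubmonoid.subset_closure ⟨i, p, hp, rfl⟩

theorem coneSpan_coneSpan (hφ : ConeTransfer φ ψ) [FiniteDimensional F R] {P : Set R}
    (hP : IsPrepositiveCone F P) : coneSpan ψ (coneSpan φ P) = P := by
  refine Set.Subset.antisymm (fun r hr => ?_) fun p hp => hφ.mem_coneSpan_coneSpan hP hp
  induction hr using AddSubmonoid.closure_induction with
  | mem z hz =>
    obtain ⟨j, s, hs, rfl⟩ := hz
    exact hφ.apply_mem_of_mem_coneSpan hP hs j
  | zero => exact hP.zero_mem
  | add z w _ _ hz hw => exact hP.add_mem _ hz _ hw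

/-- Every `ψ j` sends both `s` and `-s` into the proper cone `P`, hence kills `s`; nondegeneracy of
the family `ψ` finishes. -/
theorem eq_zero_of_mem_coneSpan (hφ : ConeTransfer φ ψ) (hψ : ConeTransfer ψ φ) {P : Set R}
    (hP : IsPrepositiveCone F P) {s : S} (hs : s ∈ coneSpan φ P) (hs' : -s ∈ coneSpan φ P) :
    s = 0 := by
  by_contra h0
  obtain ⟨j, hj⟩ := hψ.exists_ne_zero s (hφ.isSelfAdjoint_coneSpan hP hs) h0
  refine hj (hP.eq_zero (hφ.apply_mem_of_mem_coneSpan hP hs j) ?_)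
  rw [← map_neg]
  exact hφ.apply_mem_of_mem_coneSpan hP hs' j

theorem coneScalars_coneSpan (hφ : ConeTransfer φ ψ) (hψ : ConeTransfer ψ φ) {P : Set R}
    (hP : IsPrepositiveCone F P) : coneScalars F (coneSpan φ P) = coneScalars F P := by
  have hle : ∀ u ∈ coneScalars F P, u ∈ coneScalars F (coneSpan φ P) := by
    intro u hu s hs
    induction hs using AddSubmonoid.closure_induction with
    | mem z hz =>
      obtain ⟨i, p, hp, rfl⟩ := hz
      exact AddSubmonoid.subset_closure ⟨i, u • p, hu p hp, map_smul _ _ _⟩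
    | zero => rw [smul_zero]; exact AddSubmonoid.zero_mem _
    | add z w _ _ hz hw => rw [smul_add]; exact AddSubmonoid.add_mem _ hz hw
  refine Set.Subset.antisymm (fun u hu => ?_) hle
  -- Totality of the ordering leaves only `-u` to exclude; then `u` and `-u` both preserve the new
  -- proper cone, and a nonzero element of it forces `u = 0`.
  rcases hP.scalars_mem_or_neg_mem u with hpos | hneg
  · exact hpos
  obtain ⟨p, hp, hp0⟩ := hP.exists_ne_zero
  obtain ⟨i, hi⟩ := hφ.exists_ne_zero p (hP.isSelfAdjoint p hp) hp0
  have hmem : φ i p ∈ coneSpan φ P := AddSubmonoid.subset_closure ⟨i, p, hp, rfl⟩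
  have hzero : u • φ i p = 0 := by
    refine hφ.eq_zero_of_mem_coneSpan hψ hP (hu _ hmem) ?_
    rw [← neg_smul]
    exact hle _ hneg _ hmem
  have hu0 : u = 0 := (smul_eq_zero.1 hzero).resolve_right hi
  intro q _
  rw [hu0, zero_smul]
  exact hP.zero_mem

theorem isPrepositiveCone_coneSpan (hφ : ConeTransfer φ ψ) (hψ : ConeTransfer ψ φ) {P : Set R}
    (hP : IsPrepositiveCone F P) : IsPrepositiveCone F (coneSpan φ P) where
  isSelfAdjoint _ hs := hφ.isSelfAdjoint_coneSpan hP hs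
  nonempty := ⟨0, AddSubmonoid.zero_mem _⟩
  add_mem _ hs _ ht := AddSubmonoid.add_mem _ hs ht
  conj_mem a s hs := by
    induction hs using AddSubmonoid.closure_induction with
    | mem z hz =>
      obtain ⟨i, p, hp, rfl⟩ := hz
      obtain ⟨j, hj⟩ := hφ.conj i p a
      exact AddSubmonoid.subset_closure ⟨j, p, hp, hj.symm⟩
    | zero => rw [mul_zero, zero_mul]; exact AddSubmonoid.zero_mem _
    | add z w _ _ hz hw => rw [mul_add, add_mul]; exact AddSubmonoid.add_mem _ hz hw
  isFieldOrdering := by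
    rw [hφ.coneScalars_coneSpan hψ hP]
    exact hP.isFieldOrdering
  proper := by
    refine Set.Subset.antisymm (fun s hs => hφ.eq_zero_of_mem_coneSpan hψ hP hs.1 hs.2) ?_
    rintro _ rfl
    refine ⟨AddSubmonoid.zero_mem _, ?_⟩
    change -(0 : S) ∈ coneSpan φ P
    rw [neg_zero]
    exact AddSubmonoid.zero_mem _

theorem coneSpan_subset_coneSpan_iff (hφ : ConeTransfer φ ψ) [FiniteDimensional F R]
    {P Q : Set R} (hP : IsPrepositiveCone F P) (hQ : IsPrepositiveCone F Q) :
    coneSpan φ P ⊆ coneSpan φ Q ↔ P ⊆ Q := by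
  refine ⟨fun h => ?_, coneSpan_mono φ⟩
  rw [← hφ.coneSpan_coneSpan hP, ← hφ.coneSpan_coneSpan hQ]
  exact coneSpan_mono ψ h

theorem bijOn_prepositiveCones (hφ : ConeTransfer φ ψ) (hψ : ConeTransfer ψ φ)
    [FiniteDimensional F R] [FiniteDimensional F S] :
    Set.BijOn (coneSpan φ) (prepositiveCones F R) (prepositiveCones F S) :=
  Set.InvOn.bijOn ⟨fun _ hP => hφ.coneSpan_coneSpan hP, fun _ hQ => hψ.coneSpan_coneSpan hQ⟩
    (fun _ hP => hφ.isPrepositiveCone_coneSpan hψ hP)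
    fun _ hQ => hψ.isPrepositiveCone_coneSpan hφ hQ

theorem coneSpan_mem_positiveCones (hφ : ConeTransfer φ ψ) (hψ : ConeTransfer ψ φ)
    [FiniteDimensional F R] [FiniteDimensional F S] {P : Set R} (hP : P ∈ positiveCones F R) :
    coneSpan φ P ∈ positiveCones F S := by
  refine ⟨hφ.isPrepositiveCone_coneSpan hψ hP.1, fun Q hQ hPQ => ?_⟩
  have h : P ⊆ coneSpan ψ Q := by
    rw [← hφ.coneSpan_coneSpan hP.1]
    exact coneSpan_mono ψ hPQ
  rw [← hψ.coneSpan_coneSpan hQ]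
  exact coneSpan_mono φ (hP.2 (hψ.isPrepositiveCone_coneSpan hφ hQ) h)

theorem bijOn_positiveCones (hφ : ConeTransfer φ ψ) (hψ : ConeTransfer ψ φ)
    [FiniteDimensional F R] [FiniteDimensional F S] :
    Set.BijOn (coneSpan φ) (positiveCones F R) (positiveCones F S) :=
  Set.InvOn.bijOn ⟨fun _ hP => hφ.coneSpan_coneSpan hP.1, fun _ hQ => hψ.coneSpan_coneSpan hQ.1⟩
    (fun _ hP => hφ.coneSpan_mem_positiveCones hψ hP)
    fun _ hQ => hψ.coneSpan_mem_positiveCones hφ hQ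

end ConeTransfer

end transfer

/-! ### The transfer defined by a Morita equivalence -/

namespace HermForm

variable {A : Type*} [Ring A] [StarRing A] {M : Type*} [AddCommGroup M] [Module Aᵐᵒᵖ M]
  (h : HermForm A M)

theorem sum_right {κ : Type*} (s : Finset κ) (x : M) (y : κ → M) :
    h x (∑ i ∈ s, y i) = ∑ i ∈ s, h x (y i) :=
  map_sum (AddMonoidHom.mk' (h x) (h.add_right x)) y s

theorem sum_left {κ : Type*} (s : Finset κ) (x : κ → M) (y : M) :
    h (∑ i ∈ s, x i) y = ∑ i ∈ s, h (x i) y :=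
  map_sum (AddMonoidHom.mk' (h · y) fun a b => h.add_left a b y) x s

theorem zero_right (x : M) : h x 0 = 0 :=
  map_zero (AddMonoidHom.mk' (h x) (h.add_right x))

theorem zero_left (y : M) : h 0 y = 0 :=
  map_zero (AddMonoidHom.mk' (h · y) fun a b => h.add_left a b y)

end HermForm

namespace MoritaEquiv

variable {F : Type*} {A : Type*} {B : Type*} [Field F] [Ring A] [Algebra F A]
  [StarRing A] [Ring B] [Algebra F B] [StarRing B] (m : MoritaEquiv F A B)

theorem smul_ext {a a' : A} (h : ∀ n : m.N, a • n = a' • n) : a = a' := by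
  obtain ⟨c, -, hc⟩ := m.end_bijective
    { toFun := fun n => a • n, map_add' := smul_add a, map_smul' := fun d n => smul_comm a d n }
  rw [hc a fun _ => rfl, hc a' h]

theorem eq_zero_of_b_eq_zero {x : m.N} (h : ∀ y, m.b x y = 0) : x = 0 := by
  obtain ⟨c, -, hc⟩ := m.nonsingular 0
  rw [hc x fun y => (h y).symm, hc 0 fun y => (m.b.zero_left y).symm]

theorem eq_zero_of_b_eq_zero' {y : m.N} (h : ∀ x, m.b x y = 0) : y = 0 :=
  m.eq_zero_of_b_eq_zero fun x => by rw [← m.b.star_apply, h x, star_zero]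

theorem exists_smul_eq_rankOne (n : m.N) (c : B) (n' : m.N) :
    ∃ a : A, ∀ x, a • x = op (c * m.b n' x) • n := by
  obtain ⟨a, ha, -⟩ := m.end_bijective
    { toFun := fun x => op (c * m.b n' x) • n
      map_add' := fun x y => by rw [m.b.add_right, mul_add, op_add, add_smul]
      map_smul' := fun d x => by
        induction d using MulOpposite.rec' with
        | h d => rw [m.b.smul_right, ← mul_assoc, op_mul, mul_smul]; rfl }
  exact ⟨a, fun x => (ha x).symm⟩

/-- The element of `A` acting on `N` as `x ↦ n c b (n', x)`. -/
noncomputable def rankOne (n : m.N) (c : B) (n' : m.N) : A :=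
  (m.exists_smul_eq_rankOne n c n').choose

theorem rankOne_smul (n : m.N) (c : B) (n' x : m.N) :
    m.rankOne n c n' • x = op (c * m.b n' x) • n :=
  (m.exists_smul_eq_rankOne n c n').choose_spec x

theorem b_smul_right (a : A) (x y : m.N) : m.b x (a • y) = m.b (star a • x) y := by
  rw [m.adjoint, star_star]

/-- `star` on `A` is the adjoint for `b`, so the identity can be tested by pairing with all of `N`.
-/
theorem star_rankOne (n : m.N) (c : B) (n' : m.N) :
    star (m.rankOne n c n') = m.rankOne n' (star c) n := by
  refine m.smul_ext fun x => ?_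
  rw [← sub_eq_zero]
  refine m.eq_zero_of_b_eq_zero' fun y => ?_
  rw [sub_eq_add_neg, m.b.add_right, ← m.adjoint, rankOne_smul, rankOne_smul, m.b.smul_left,
    ← neg_smul, ← op_neg, m.b.smul_right, star_mul, m.b.star_apply, mul_neg, mul_assoc,
    add_neg_cancel]

theorem mul_rankOne (a : A) (n : m.N) (c : B) (n' : m.N) :
    a * m.rankOne n c n' = m.rankOne (a • n) c n' :=
  m.smul_ext fun x => by rw [mul_smul, rankOne_smul, rankOne_smul, smul_comm]

theorem rankOne_mul (a : A) (n : m.N) (c : B) (n' : m.N) :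
    m.rankOne n c n' * a = m.rankOne n c (star a • n') :=
  m.smul_ext fun x => by rw [mul_smul, rankOne_smul, rankOne_smul, b_smul_right]

theorem rankOne_mul_rankOne (n : m.N) (c : B) (n' k : m.N) (d : B) (k' : m.N) :
    m.rankOne n c n' * m.rankOne k d k' = m.rankOne n (c * m.b n' k * d) k' :=
  m.smul_ext fun x => by
    rw [mul_smul, rankOne_smul, rankOne_smul, rankOne_smul, m.b.smul_right, mul_assoc, mul_assoc]

theorem rankOne_add (n : m.N) (c d : B) (n' : m.N) :
    m.rankOne n (c + d) n' = m.rankOne n c n' + m.rankOne n d n' :=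
  m.smul_ext fun x => by
    rw [add_smul, rankOne_smul, rankOne_smul, rankOne_smul, add_mul, op_add, add_smul]

theorem smul_smul_eq_op_smul (u : F) (a : A) (n : m.N) :
    (u • a) • n = op (algebraMap F B u) • a • n := by
  rw [Algebra.smul_def, mul_smul, m.algebraMap_smul]

theorem rankOne_smul_middle (u : F) (n : m.N) (c : B) (n' : m.N) :
    m.rankOne n (u • c) n' = u • m.rankOne n c n' :=
  m.smul_ext fun x => by
    rw [smul_smul_eq_op_smul, rankOne_smul, rankOne_smul, ← mul_smul, ← op_mul, smul_mul_assoc,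
      Algebra.smul_def, Algebra.commutes]

/-- The map `a ↦ b (n, a n)`. -/
def toTarget (n : m.N) : A →ₗ[F] B where
  toFun a := m.b n (a • n)
  map_add' a a' := by rw [add_smul, m.b.add_right]
  map_smul' u a := by
    rw [smul_smul_eq_op_smul, m.b.smul_right, RingHom.id_apply, Algebra.smul_def,
      Algebra.commutes]

/-- The map `c ↦ n c b (n, ·)`. -/
noncomputable def toSource (n : m.N) : B →ₗ[F] A where
  toFun c := m.rankOne n c n
  map_add' c d := m.rankOne_add n c d n
  map_smul' u c := m.rankOne_smul_middle u n c n

theorem toTarget_apply (n : m.N) (a : A) : m.toTarget n a = m.b n (a • n) := rfl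

theorem toSource_apply (n : m.N) (c : B) : m.toSource n c = m.rankOne n c n := rfl

theorem isSelfAdjoint_toTarget (n : m.N) {a : A} (ha : IsSelfAdjoint a) :
    IsSelfAdjoint (m.toTarget n a) := by
  rw [isSelfAdjoint_iff, toTarget_apply, m.b.star_apply, m.adjoint, ha.star_eq]

theorem isSelfAdjoint_toSource (n : m.N) {c : B} (hc : IsSelfAdjoint c) :
    IsSelfAdjoint (m.toSource n c) := by
  rw [isSelfAdjoint_iff, toSource_apply, star_rankOne, hc.star_eq]

theorem star_mul_toTarget_mul (n : m.N) (a : A) (c : B) :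
    star c * m.toTarget n a * c = m.toTarget (op c • n) a := by
  rw [toTarget_apply, toTarget_apply, smul_comm, m.b.smul_right, m.b.smul_left]

theorem star_mul_toSource_mul (n : m.N) (c : B) (a : A) :
    star a * m.toSource n c * a = m.toSource (star a • n) c := by
  rw [toSource_apply, toSource_apply, mul_rankOne, rankOne_mul]

/-- The operator `k b(n, a n) b(k, ·)` factors as `k b(n, ·)`, `a` and `n b(k, ·)`, the outer two
being adjoint to each other. -/
theorem toSource_toTarget (n k : m.N) (a : A) :
    m.toSource k (m.toTarget n a) = star (m.rankOne n 1 k) * a * m.rankOne n 1 k := by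
  rw [star_rankOne, mul_assoc, mul_rankOne, rankOne_mul_rankOne, star_one, one_mul, mul_one]
  rfl

theorem toTarget_toSource (n k : m.N) (c : B) :
    m.toTarget k (m.toSource n c) = star (m.b n k) * c * m.b n k := by
  rw [toSource_apply, toTarget_apply, rankOne_smul, m.b.smul_right, m.b.star_apply, mul_assoc]

/-! ### Nondegeneracy and orthogonal splitting, from simplicity and `2 ≠ 0` -/

section simple

/-- If the hermitian form `b(·, a ·)` vanished on the diagonal, polarisation would make all its
values skew, although they form an absorbing subset of the simple ring `B`. -/
theorem exists_toTarget_ne_zero (hF : (2 : F) ≠ 0) [IsSimpleRing B] {a : A}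
    (ha : IsSelfAdjoint a) (ha0 : a ≠ 0) : ∃ n, m.toTarget n a ≠ 0 := by
  by_contra! h
  have hskew : ∀ n n' : m.N, m.b n (a • n') + m.b n' (a • n) = 0 := by
    intro n n'
    have := h (n + n')
    rwa [toTarget_apply, smul_add, m.b.add_right, m.b.add_left, m.b.add_left, ← toTarget_apply,
      ← toTarget_apply, h, h, zero_add, add_zero, add_comm] at this
  obtain ⟨n, n', hn⟩ : ∃ n n' : m.N, m.b n (a • n') ≠ 0 := by
    by_contra! h0
    refine ha0 (m.smul_ext fun n' => ?_)
    rw [zero_smul]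
    exact m.eq_zero_of_b_eq_zero' fun n => h0 n n'
  refine one_notMem_closure_of_skew (s := {c | ∃ n n' : m.N, m.b n (a • n') = c}) hF ?_
    (one_mem_closure_of_absorbing ?_ ?_ ⟨n, n', rfl⟩ hn)
  · rintro _ ⟨n, n', rfl⟩
    rw [m.b.star_apply, m.adjoint, ha.star_eq, eq_neg_iff_add_eq_zero, hskew]
  · rintro c _ ⟨n, n', rfl⟩
    exact ⟨op (star c) • n, n', by rw [m.b.smul_left, star_star]⟩
  · rintro c _ ⟨n, n', rfl⟩
    exact ⟨n, op c • n', by rw [smul_comm, m.b.smul_right]⟩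

theorem one_mem_closure_range_b [Nontrivial A] [IsSimpleRing B] :
    (1 : B) ∈ AddSubgroup.closure {c | ∃ n n' : m.N, m.b n n' = c} := by
  obtain ⟨n, n', hn⟩ : ∃ n n' : m.N, m.b n n' ≠ 0 := by
    by_contra! h0
    refine one_ne_zero (α := A) (m.smul_ext fun n' => ?_)
    rw [zero_smul, one_smul]
    exact m.eq_zero_of_b_eq_zero' fun n => h0 n n'
  refine one_mem_closure_of_absorbing ?_ ?_ ⟨n, n', rfl⟩ hn
  · rintro c _ ⟨n, n', rfl⟩
    exact ⟨op (star c) • n, n', by rw [m.b.smul_left, star_star]⟩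
  · rintro c _ ⟨n, n', rfl⟩
    exact ⟨n, op c • n', by rw [m.b.smul_right]⟩

/-- The values of `b` generate `1` additively. Used once this gives `N c = 0`; used again, on `b(k,
k' c) = b(k, k') c`, it gives `c = 0`. -/
theorem eq_zero_of_rankOne_eq_zero [Nontrivial A] [IsSimpleRing B] {c : B}
    (h : ∀ n n' : m.N, m.rankOne n c n' = 0) : c = 0 := by
  have hc : ∀ d ∈ AddSubgroup.closure {d | ∃ n n' : m.N, m.b n n' = d}, ∀ n : m.N,
      op (c * d) • n = 0 := fun d hd n => by
    induction hd using AddSubgroup.closure_induction with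
    | mem d hd =>
      obtain ⟨k, k', rfl⟩ := hd
      rw [← rankOne_smul, h, zero_smul]
    | zero => simp
    | add d d' _ _ hd hd' => rw [mul_add, op_add, add_smul, hd, hd', add_zero]
    | neg d _ hd => rw [mul_neg, op_neg, neg_smul, hd, neg_zero]
  have hN : ∀ n : m.N, op c • n = 0 := by
    simpa using hc 1 m.one_mem_closure_range_b
  have hB : ∀ d ∈ AddSubgroup.closure {d | ∃ n n' : m.N, m.b n n' = d}, d * c = 0 :=
      fun d hd => by
    induction hd using AddSubgroup.closure_induction with
    | mem d hd =>
      obtain ⟨k, k', rfl⟩ := hd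
      rw [← m.b.smul_right, hN, m.b.zero_right]
    | zero => simp
    | add d d' _ _ hd hd' => rw [add_mul, hd, hd', add_zero]
    | neg d _ hd => rw [neg_mul, hd, neg_zero]
  simpa using hB 1 m.one_mem_closure_range_b

theorem rankOne_add_left (n k : m.N) (c : B) (n' : m.N) :
    m.rankOne (n + k) c n' = m.rankOne n c n' + m.rankOne k c n' :=
  m.smul_ext fun x => by
    rw [add_smul, rankOne_smul, rankOne_smul, rankOne_smul, smul_add]

theorem rankOne_add_right (n : m.N) (c : B) (n' k : m.N) :
    m.rankOne n c (n' + k) = m.rankOne n c n' + m.rankOne n c k :=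
  m.smul_ext fun x => by
    rw [add_smul, rankOne_smul, rankOne_smul, rankOne_smul, m.b.add_left, mul_add, op_add,
      add_smul]

theorem exists_toSource_ne_zero (hF : (2 : F) ≠ 0) [IsSimpleRing A] [IsSimpleRing B] {c : B}
    (hc : IsSelfAdjoint c) (hc0 : c ≠ 0) : ∃ n, m.toSource n c ≠ 0 := by
  by_contra! h
  have hskew : ∀ n n' : m.N, m.rankOne n' c n + m.rankOne n c n' = 0 := by
    intro n n'
    have := h (n + n')
    rwa [toSource_apply, rankOne_add_right, rankOne_add_left, rankOne_add_left, ← toSource_apply,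
      ← toSource_apply, h, h, zero_add, add_zero] at this
  obtain ⟨n, n', hn⟩ : ∃ n n' : m.N, m.rankOne n c n' ≠ 0 := by
    by_contra! h0
    exact hc0 (m.eq_zero_of_rankOne_eq_zero h0)
  refine one_notMem_closure_of_skew (s := {a | ∃ n n' : m.N, m.rankOne n c n' = a}) hF ?_
    (one_mem_closure_of_absorbing ?_ ?_ ⟨n, n', rfl⟩ hn)
  · rintro _ ⟨n, n', rfl⟩
    rw [star_rankOne, hc.star_eq, eq_neg_iff_add_eq_zero, hskew]
  · rintro a _ ⟨n, n', rfl⟩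
    exact ⟨a • n, n', (m.mul_rankOne ..).symm⟩
  · rintro a _ ⟨n, n', rfl⟩
    exact ⟨n, star a • n', (m.rankOne_mul ..).symm⟩

/-- The idempotent is `e = n d b(a n, ·)`, the projection along `n` for the form `b(·, a ·)`, where
`d` is a generalised inverse of `b(n, a n)`. -/
theorem coneTransfer_toTarget (hF : (2 : F) ≠ 0) [IsSimpleRing B] [IsSemisimpleRing B] :
    ConeTransfer m.toTarget m.toSource where
  isSelfAdjoint n _ ha := m.isSelfAdjoint_toTarget n ha
  conj n a c := ⟨_, m.star_mul_toTarget_mul n a c⟩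
  comp n k a := ⟨_, m.toSource_toTarget n k a⟩
  exists_ne_zero _ ha ha0 := m.exists_toTarget_ne_zero hF ha ha0
  exists_idempotent a ha ha0 := by
    obtain ⟨n, hn⟩ := m.exists_toTarget_ne_zero hF ha ha0
    obtain ⟨d, hd, hdc, hcd⟩ :=
      exists_isSelfAdjoint_generalized_inverse (m.isSelfAdjoint_toTarget n ha)
    have hc : m.b (a • n) n = m.toTarget n a := by
      rw [m.adjoint, ha.star_eq, toTarget_apply]
    -- Absorbing `d` into the left vector gives `e` the shape of the conjugator in
    -- `toSource_toTarget`.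
    have hform : m.rankOne n d (a • n) = m.rankOne (op d • n) 1 (a • n) :=
      m.smul_ext fun x => by rw [rankOne_smul, rankOne_smul, one_mul, op_mul, mul_smul]
    refine ⟨m.rankOne n d (a • n), ?_, ?_, fun h0 => hn ?_, op d • n, a • n, ?_⟩
    · rw [rankOne_mul_rankOne, hc, hdc]
    · rw [mul_rankOne, star_rankOne, rankOne_mul, hd.star_eq, ha.star_eq]
    -- With `c = b(n, a n)`, one has `c = c d c = b(n, a e n)`, which would vanish with `a e`.
    · rw [← hcd, ← hc, mul_assoc, ← m.b.smul_right, m.adjoint, ha.star_eq, ← rankOne_smul,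
        ← mul_smul, h0, zero_smul, m.b.zero_right]
    · rw [toSource_toTarget, hform]

theorem coneTransfer_toSource (hF : (2 : F) ≠ 0) [IsSimpleRing A] [IsSemisimpleRing A]
    [IsSimpleRing B] : ConeTransfer m.toSource m.toTarget where
  isSelfAdjoint n _ hc := m.isSelfAdjoint_toSource n hc
  conj n c a := ⟨_, m.star_mul_toSource_mul n c a⟩
  comp n k c := ⟨_, m.toTarget_toSource n k c⟩
  exists_ne_zero _ hc hc0 := m.exists_toSource_ne_zero hF hc hc0
  exists_idempotent c hc hc0 := by
    obtain ⟨n, hn⟩ := m.exists_toSource_ne_zero hF hc hc0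
    obtain ⟨d, hd, hdc, hcd⟩ :=
      exists_isSelfAdjoint_generalized_inverse (m.isSelfAdjoint_toSource n hc)
    rw [toSource_apply] at hn hdc hcd
    have hform : m.b n (d • n) * c = m.b n (op c • d • n) := (m.b.smul_right ..).symm
    -- Let `T = n c b(n, ·)`, with generalised inverse `d` in `A`. Then `d T d = d` makes `e = b(n,
    -- d n) c` idempotent, and `T = T d T = n (c e) b(n, ·)` shows `c e ≠ 0`. By `hform`, `e` is
    -- itself a value of `b`, as `toTarget_toSource` requires.
    refine ⟨m.b n (d • n) * c, ?_, ?_, fun h0 => hn ?_, n, op c • d • n, ?_⟩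
    · conv_rhs => rw [← hdc]
      rw [mul_smul, mul_smul, rankOne_smul, smul_comm d, m.b.smul_right]
      noncomm_ring
    · rw [star_mul, hc.star_eq, m.b.star_apply, m.adjoint, hd.star_eq, mul_assoc]
    · rw [← hcd, mul_assoc, mul_rankOne, rankOne_mul_rankOne, mul_assoc c, h0]
      refine m.smul_ext fun x => ?_
      rw [rankOne_smul, zero_smul, zero_mul, op_zero, zero_smul]
    · rw [toTarget_toSource, hform]

end simple

/-! ### The cone `𝔪_*(P)` -/

theorem tensor_exists_sum {M : Type*} [AddCommGroup M] [Module Aᵐᵒᵖ M] (z : m.Tensor M) :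
    ∃ (k : ℕ) (x : Fin k → M) (n : Fin k → m.N), z = ∑ j, m.tmul (x j) (n j) := by
  obtain ⟨z, rfl⟩ := (m.relations M).mkQ_surjective z
  induction z using TensorProduct.induction_on with
  | zero => exact ⟨0, Fin.elim0, Fin.elim0, by simp⟩
  | tmul n x => exact ⟨1, fun _ => x, fun _ => n, by simp [tmul]⟩
  | add z w hz hw =>
    obtain ⟨k, x, n, hz⟩ := hz
    obtain ⟨l, y, n', hw⟩ := hw
    refine ⟨k + l, Fin.append x y, Fin.append n n', ?_⟩
    rw [map_add, hz, hw, Fin.sum_univ_add]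
    simp

theorem tensorForm_sum {M : Type*} [AddCommGroup M] [Module Aᵐᵒᵖ M] (h : HermForm A M) {l : ℕ}
    (x : Fin l → M) (n : Fin l → m.N) :
    m.tensorForm h (∑ j, m.tmul (x j) (n j)) (∑ j, m.tmul (x j) (n j)) =
      ∑ j, ∑ j', m.b (n j) (h (x j) (x j') • n j') := by
  simp only [HermForm.sum_left, HermForm.sum_right, tensorForm_tmul]
  exact Finset.sum_comm

/-- Under `A^k ⊗_A N = N^k` the tensor has `i`-th coordinate `∑ j, x j i • n j`, and the form
becomes the orthogonal sum of the `b(·, a i ·)`. -/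
theorem tensorForm_diagForm_sum {k l : ℕ} (a : Fin k → A) (ha : ∀ i, IsSelfAdjoint (a i))
    (x : Fin l → Fin k → A) (n : Fin l → m.N) :
    m.tensorForm (diagForm a ha).form (∑ j, m.tmul (M := (diagForm a ha).carrier) (x j) (n j))
      (∑ j, m.tmul (M := (diagForm a ha).carrier) (x j) (n j)) =
      ∑ i, m.toTarget (∑ j, x j i • n j) (a i) := by
  refine (m.tensorForm_sum _ _ _).trans ?_
  change ∑ j, ∑ j', m.b (n j) ((∑ i, star (x j i) * a i * x j' i) • n j') = _
  simp only [Finset.sum_smul, HermForm.sum_right, HermForm.sum_left, toTarget_apply,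
    Finset.smul_sum, mul_smul, ← m.adjoint]
  rw [Finset.sum_comm]
  conv_rhs => rw [Finset.sum_comm]
  exact Finset.sum_congr rfl fun j' _ => Finset.sum_comm

theorem mapCone_eq_coneSpan {P : Set A} (hP : ∀ p ∈ P, IsSelfAdjoint p) :
    m.mapCone P = coneSpan m.toTarget P := by
  refine Set.Subset.antisymm ?_ ?_
  · intro c hc
    simp only [mapCone, Set.mem_iUnion] at hc
    obtain ⟨_, ⟨k, a, ha, haP, rfl⟩, -, z, hz⟩ := hc
    obtain ⟨l, x, n, hx⟩ := m.tensor_exists_sum (M := (diagForm a ha).carrier) z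
    have h := m.tensorForm_diagForm_sum a ha x n
    rw [← hx] at h
    rw [← hz]
    change m.tensorForm (diagForm a ha).form z z ∈ _
    rw [h]
    exact AddSubmonoid.sum_mem _ fun i _ => AddSubmonoid.subset_closure ⟨_, a i, haP i, rfl⟩
  · intro c hc
    obtain ⟨k, n, a, haP, rfl⟩ : ∃ (k : ℕ) (n : Fin k → m.N) (a : Fin k → A),
        (∀ i, a i ∈ P) ∧ c = ∑ i, m.toTarget (n i) (a i) := by
      induction hc using AddSubmonoid.closure_induction with
      | mem c hc =>
        obtain ⟨n, p, hp, rfl⟩ := hc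
        exact ⟨1, fun _ => n, fun _ => p, fun _ => hp, by simp⟩
      | zero => exact ⟨0, Fin.elim0, Fin.elim0, fun i => i.elim0, by simp⟩
      | add c d _ _ hc hd =>
        obtain ⟨k, n, a, ha, rfl⟩ := hc
        obtain ⟨l, n', a', ha', rfl⟩ := hd
        refine ⟨k + l, Fin.append n n', Fin.append a a', fun i => ?_, ?_⟩
        · refine Fin.addCases (fun i => ?_) (fun i => ?_) i
          · rw [Fin.append_left]; exact ha i
          · rw [Fin.append_right]; exact ha' i
        · rw [Fin.sum_univ_add]
          simp
    have ha : ∀ i, IsSelfAdjoint (a i) := fun i => hP _ (haP i)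
    -- Tensoring the standard basis of `A^k` with the `n j` realises any prescribed coordinates in
    -- `N^k`.
    have h := m.tensorForm_diagForm_sum a ha (fun j => Pi.single j 1) n
    have hn : ∀ i, ∑ j, (Pi.single j 1 : Fin k → A) i • n j = n i := by
      intro i
      rw [Finset.sum_eq_single i]
      · rw [Pi.single_eq_same, one_smul]
      · intro j _ hj
        rw [Pi.single_eq_of_ne hj.symm, zero_smul]
      · simp
    simp only [hn] at h
    simp only [mapCone, Set.mem_iUnion]
    refine ⟨diagForm a ha, ⟨k, a, ha, haP, rfl⟩, ?_, _, h⟩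
    rw [← h]
    exact (m.tensorForm (diagForm a ha).form).star_apply _ _

end MoritaEquiv

end PosCone

/-! ### The main theorem -/

open PosCone
theorem theorem4p1 {F : Type*} {A : Type*} {B : Type*} [Field F] (hF : (2 : F) ≠ 0)
    [Ring A] [Algebra F A] [StarRing A] [IsAlgebraWithInvolution F A]
    [Ring B] [Algebra F B] [StarRing B] [IsAlgebraWithInvolution F B]
    (htype : SameType F A B) (𝔪 : MoritaEquiv F A B) :
    Set.BijOn 𝔪.mapCone (prepositiveCones F A) (prepositiveCones F B) ∧
    (∀ P ∈ prepositiveCones F A, ∀ Q ∈ prepositiveCones F A,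
      P ⊆ Q ↔ 𝔪.mapCone P ⊆ 𝔪.mapCone Q) ∧
    Set.BijOn 𝔪.mapCone (positiveCones F A) (positiveCones F B) ∧
    (∀ P ∈ prepositiveCones F A, ∀ O : Set F, IsFieldOrdering O →
      coneScalars F P = O → coneScalars F (𝔪.mapCone P) = O) := by
  have : FiniteDimensional F A := IsAlgebraWithInvolution.finiteDimensional
  have : FiniteDimensional F B := IsAlgebraWithInvolution.finiteDimensional
  have : IsSimpleRing A := IsAlgebraWithInvolution.isSimpleRing F
  have : IsSimpleRing B := IsAlgebraWithInvolution.isSimpleRing F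
  have : IsArtinianRing A := .of_finite F A
  have : IsArtinianRing B := .of_finite F B
  have : IsSemisimpleRing A := IsSimpleRing.isSemisimpleRing_iff_isArtinianRing.2 inferInstance
  have : IsSemisimpleRing B := IsSimpleRing.isSemisimpleRing_iff_isArtinianRing.2 inferInstance
  have hφ := 𝔪.coneTransfer_toTarget hF
  have hψ := 𝔪.coneTransfer_toSource hF
  have heq : Set.EqOn (coneSpan 𝔪.toTarget) 𝔪.mapCone (prepositiveCones F A) := fun P hP =>
    (𝔪.mapCone_eq_coneSpan (IsPrepositiveCone.isSelfAdjoint hP)).symm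
  refine ⟨(hφ.bijOn_prepositiveCones hψ).congr heq, fun P hP Q hQ => ?_,
    (hφ.bijOn_positiveCones hψ).congr fun P hP => heq hP.1, fun P hP O _ hO => ?_⟩
  · rw [← heq hP, ← heq hQ, hφ.coneSpan_subset_coneSpan_iff hP hQ]
  · rw [← heq hP, hφ.coneScalars_coneSpan hψ hP, hO]
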